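/- Let $\mathcal L$ be a finite bounded distributive lattice with $0\neq 1$, regarded as a Heyting algebra, and for $\ell,x\in\mathcal L$ put $T_\ell(x)=1$ if $x=\ell$ and $T_\ell(x)=0$ otherwise. An $\mathcal L$-$\mathcal{VL}$-algebra is a structure $(\mathcal A,\wedge,\vee,\rightarrow,T_\ell\,(\ell\in\mathcal L),0,1)$ such that $(\mathcal A,\wedge,\vee,\rightarrow,0,1)$ is a Heyting algebra and, for all $a,b\in\mathcal A$ and $\ell,\ell_1,\ell_2\in\mathcal L$: (1) $T_{\ell_1}(a)\wedge T_{\ell_2}(b)\le T_{\ell_1\rightarrow \ell_2}(a\rightarrow b)\wedge T_{\ell_1\wedge \ell_2}(a\wedge b)\wedge T_{\ell_1\vee \ell_2}(a\vee b)$ and $T_{\ell_2}(a)\le T_{T_{\ell_1}(\ell_2)}(T_{\ell_1}(a))$; (2) $T_0(0)=1$, $T_\ell(0)=0$ if $\ell\ne0$, $T_1(1)=1$, $T_\ell(1)=0$ if $\ell\neq1$; (3) $\bigvee_{\ell\in\mathcal L}T_\ell(a)=1$, $T_\ell(a)\vee(T_\ell(a)\rightarrow0)=1$, and $T_{\ell_1}(a)\wedge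 T_{\ell_2}(a)=0$ if $\ell_1\ne \ell_2$; (4) $T_1(T_\ell(a))=T_\ell(a)$, $T_0(T_\ell(a))=T_\ell(a)\rightarrow0$, and $T_{\ell_2}(T_{\ell_1}(a))=0$ if $\ell_2\ne0,1$; (5) $T_1(a)\le a$ and $T_1(a\wedge b)=T_1(a)\wedge T_1(b)$; (6) $\bigwedge_{\ell\in\mathcal L}(T_\ell(a)\leftrightarrow T_\ell(b))\le (a\leftrightarrow b)$. Let $\mathcal{VA}_{\mathcal L}$ be the category of $\mathcal L$-$\mathcal{VL}$-algebras and maps preserving all the operations. The lattice $\mathcal L$ is itself an object of it. A bitopological space $(B,\tau_1,\tau_2)$ is a pairwise Boolean space if (a) the $\tau_1$-open $\tau_2$-closed sets form a basis of $\tau_1$ and the $\tau_2$-open $\tau_1$-closed sets form a basis of $\tau_2$; (b) for all $x,y\in B$ with $x\ne y$ there are disjoint $U\in\tau_1$, $V\in\tau_2$ with $x\in U$, $y\in V$; (c) every cover of $B$ by members of $\tau_1\cup\tau_2$ has a finite subcover. An object of the category $PBS_{\mathcal L}$ is a pairwise Boolean space $B$ with a map $\alpha_B$ that assigns to every subalgebra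 $\mathcal M$ of $\mathcal L$ (a subset closed under $\wedge,\vee,\rightarrow$, all $T_\ell$, $0$ and $1$) a subset $\alpha_B(\mathcal M)$ of $B$ that is both $\tau_1$-closed and $\tau_2$-closed, with $\alpha_B(\mathcal L)=B$ and $\alpha_B(\mathcal M\cap\mathcal N)=\alpha_B(\mathcal M)\cap\alpha_B(\mathcal N)$. A morphism $f:(B,\alpha_B)\to(B',\alpha_{B'})$ is a map that is continuous for both the first and the second topologies and satisfies $f(\alpha_B(\mathcal M))\subseteq\alpha_{B'}(\mathcal M)$ for every subalgebra $\mathcal M$. The lattice $\mathcal L$, with the discrete topology taken twice and $\alpha_{\mathcal L}(\mathcal M)=\mathcal M$, is an object of $PBS_{\mathcal L}$. Let $F:PBS_{\mathcal L}^{op}\to\mathcal{VA}_{\mathcal L}$ send $(B,\alpha_B)$ to $\mathrm{Hom}_{PBS_{\mathcal L}}((B,\alpha_B),(\mathcal L,\alpha_{\mathcal L}))$ with the pointwise operations and act on morphisms by composition. Let $G:\mathcal{VA}_{\mathcal L}\to PBS_{\mathcal L}^{op}$ send $\mathcal A$ to $\mathrm{Hom}_{\mathcal{VA}_{\mathcal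 L}}(\mathcal A,\mathcal L)$, whose first topology has as a basis the sets $\langle a\rangle=\{v: v(a)=1\}$, $a\in\mathcal A$, and whose second topology has as a basis their complements, together with $\alpha_{\mathcal A}(\mathcal M)=\{v: v(\mathcal A)\subseteq\mathcal M\}$, and act on morphisms by composition. Then the categories $\mathcal{VA}_{\mathcal L}$ and $PBS_{\mathcal L}$ are dually equivalent: there is an equivalence of categories between $\mathcal{VA}_{\mathcal L}$ and $PBS_{\mathcal L}^{op}$ given by the functors $G$ and $F$. -/

import Mathlib

open CategoryTheory TopologicalSpace
open scoped Topology

universe u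

/-! ### Algebras of lattice-valued logic

A finite bounded distributive lattice carries exactly one Heyting implication, so the truth value
lattice `L` is given as a finite Heyting algebra. -/

open Classical in
/-- The operation `T_l` on the lattice of truth values itself: `T_l(x) = 1` if `x = l`, and
`T_l(x) = 0` otherwise. -/
noncomputable def truthT {L : Type u} [HeytingAlgebra L] (l x : L) : L :=
  if x = l then ⊤ else ⊥

/-- `L`-`VL`-algebras: Heyting algebras `A` with unary operations `T_l`, `l ∈ L`. -/
class VLAlgebra (L : Type u) [HeytingAlgebra L] [Fintype L] (A : Type u) [HeytingAlgebra A] where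
  /-- the operations `T_l` -/
  T : L → A → A
  T_himp_inf_sup : ∀ (l₁ l₂ : L) (a b : A),
    T l₁ a ⊓ T l₂ b ≤ T (l₁ ⇨ l₂) (a ⇨ b) ⊓ T (l₁ ⊓ l₂) (a ⊓ b) ⊓ T (l₁ ⊔ l₂) (a ⊔ b)
  T_le_T_truthT : ∀ (l₁ l₂ : L) (a : A), T l₂ a ≤ T (truthT l₁ l₂) (T l₁ a)
  T_bot_bot : T ⊥ ⊥ = ⊤
  T_of_ne_bot : ∀ l : L, l ≠ ⊥ → T l ⊥ = ⊥
  T_top_top : T ⊤ ⊤ = ⊤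
  T_of_ne_top : ∀ l : L, l ≠ ⊤ → T l ⊤ = ⊥
  sup_T : ∀ a : A, (Finset.univ.sup fun l : L => T l a) = ⊤
  T_sup_himp_bot : ∀ (l : L) (a : A), T l a ⊔ (T l a ⇨ ⊥) = ⊤
  T_inf_T : ∀ (l₁ l₂ : L) (a : A), l₁ ≠ l₂ → T l₁ a ⊓ T l₂ a = ⊥
  T_top_T : ∀ (l : L) (a : A), T ⊤ (T l a) = T l a
  T_bot_T : ∀ (l : L) (a : A), T ⊥ (T l a) = (T l a ⇨ ⊥)
  T_T : ∀ (l₁ l₂ : L) (a : A), l₂ ≠ ⊥ → l₂ ≠ ⊤ → T l₂ (T l₁ a) = ⊥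
  T_top_le : ∀ a : A, T ⊤ a ≤ a
  T_top_inf : ∀ a b : A, T ⊤ (a ⊓ b) = T ⊤ a ⊓ T ⊤ b
  inf_T_iff_le : ∀ a b : A,
    (Finset.univ.inf fun l : L => (T l a ⇨ T l b) ⊓ (T l b ⇨ T l a)) ≤ (a ⇨ b) ⊓ (b ⇨ a)

/-- Homomorphisms of `L`-`VL`-algebras: maps preserving all the operations. -/
@[ext]
structure VLHom (L : Type u) [HeytingAlgebra L] [Fintype L] (A B : Type u)
    [HeytingAlgebra A] [VLAlgebra L A] [HeytingAlgebra B] [VLAlgebra L B] where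
  /-- the underlying map -/
  toFun : A → B
  map_inf : ∀ a b, toFun (a ⊓ b) = toFun a ⊓ toFun b
  map_sup : ∀ a b, toFun (a ⊔ b) = toFun a ⊔ toFun b
  map_himp : ∀ a b, toFun (a ⇨ b) = (toFun a ⇨ toFun b)
  map_T : ∀ (l : L) (a : A), toFun (VLAlgebra.T l a) = VLAlgebra.T l (toFun a)
  map_bot : toFun ⊥ = ⊥
  map_top : toFun ⊤ = ⊤

/-- The objects of the category of `L`-`VL`-algebras. -/
structure VLAlg (L : Type u) [HeytingAlgebra L] [Fintype L] where
  /-- the underlying type -/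
  carrier : Type u
  [heyting : HeytingAlgebra carrier]
  [vl : VLAlgebra L carrier]

attribute [instance] VLAlg.heyting VLAlg.vl

/-- The category of `L`-`VL`-algebras and homomorphisms. -/
instance VLAlg.category (L : Type u) [HeytingAlgebra L] [Fintype L] : Category (VLAlg L) where
  Hom A B := VLHom L A.carrier B.carrier
  id A :=
    { toFun := fun a => a
      map_inf := fun _ _ => rfl
      map_sup := fun _ _ => rfl
      map_himp := fun _ _ => rfl
      map_T := fun _ _ => rfl
      map_bot := rfl
      map_top := rfl }
  comp f g :=
    { toFun := fun a => g.toFun (f.toFun a)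
      map_inf := fun a b => by rw [f.map_inf, g.map_inf]
      map_sup := fun a b => by rw [f.map_sup, g.map_sup]
      map_himp := fun a b => by rw [f.map_himp, g.map_himp]
      map_T := fun l a => by rw [f.map_T, g.map_T]
      map_bot := by rw [f.map_bot, g.map_bot]
      map_top := by rw [f.map_top, g.map_top] }

/-- The lattice of truth values is itself an `L`-`VL`-algebra. -/
noncomputable instance truthVLAlgebra (L : Type u) [HeytingAlgebra L] [Fintype L] :
    VLAlgebra L L where
  T := truthT
  T_himp_inf_sup l₁ l₂ a b := by
    unfold truthT
    by_cases h₁ : a = l₁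
    · by_cases h₂ : b = l₂
      · simp [h₁, h₂]
      · simp [h₂]
    · simp [h₁]
  T_le_T_truthT l₁ l₂ a := by
    unfold truthT
    by_cases h : a = l₂
    · subst h
      simp
    · simp [h]
  T_bot_bot := by simp [truthT]
  T_of_ne_bot l h := by simp [truthT, h.symm]
  T_top_top := by simp [truthT]
  T_of_ne_top l h := by simp [truthT, h.symm]
  sup_T a := by
    refine top_le_iff.1 (le_trans ?_ (Finset.le_sup (Finset.mem_univ a)))
    simp [truthT]
  T_sup_himp_bot l a := by
    unfold truthT
    by_cases h : a = l
    · simp [h]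
    · simp [h]
  T_inf_T l₁ l₂ a h := by
    unfold truthT
    by_cases h₁ : a = l₁
    · have h₂ : a ≠ l₂ := fun h' => h (h₁.symm.trans h')
      simp [h₂]
    · simp [h₁]
  T_top_T l a := by
    unfold truthT
    by_cases h : a = l
    · simp [h]
    · by_cases h' : (⊥ : L) = ⊤
      · simp [h, h']
      · simp [h, h']
  T_bot_T l a := by
    unfold truthT
    by_cases h : a = l
    · by_cases h' : (⊤ : L) = ⊥
      · simp [h, h']
      · simp [h, h']
    · simp [h]
  T_T l₁ l₂ a h h' := by
    unfold truthT
    by_cases h₁ : a = l₁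
    · simp [h₁, h'.symm]
    · simp [h₁, h.symm]
  T_top_le a := by
    unfold truthT
    by_cases h : a = ⊤
    · simp [h]
    · simp [h]
  T_top_inf a b := by
    unfold truthT
    by_cases h : a = ⊤
    · by_cases h' : b = ⊤
      · simp [h, h']
      · simp [h, h']
    · simp [h]
  inf_T_iff_le a b := by
    refine le_trans (Finset.inf_le (Finset.mem_univ a)) ?_
    unfold truthT
    by_cases h : b = a
    · simp [h]
    · simp [h]

/-- Subalgebras of the lattice of truth values. -/
@[ext]
structure TruthSubalgebra (L : Type u) [HeytingAlgebra L] [Fintype L] where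
  /-- the underlying set -/
  carrier : Set L
  inf_mem : ∀ {x y}, x ∈ carrier → y ∈ carrier → x ⊓ y ∈ carrier
  sup_mem : ∀ {x y}, x ∈ carrier → y ∈ carrier → x ⊔ y ∈ carrier
  himp_mem : ∀ {x y}, x ∈ carrier → y ∈ carrier → (x ⇨ y) ∈ carrier
  T_mem : ∀ (l : L) {x}, x ∈ carrier → VLAlgebra.T l x ∈ carrier
  bot_mem : ⊥ ∈ carrier
  top_mem : ⊤ ∈ carrier

/-- `L` as a subalgebra of itself. -/
instance TruthSubalgebra.instTop (L : Type u) [HeytingAlgebra L] [Fintype L] :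
    Top (TruthSubalgebra L) where
  top :=
    { carrier := Set.univ
      inf_mem := fun _ _ => Set.mem_univ _
      sup_mem := fun _ _ => Set.mem_univ _
      himp_mem := fun _ _ => Set.mem_univ _
      T_mem := fun _ _ _ => Set.mem_univ _
      bot_mem := Set.mem_univ _
      top_mem := Set.mem_univ _ }

/-- The intersection of two subalgebras. -/
instance TruthSubalgebra.instMin (L : Type u) [HeytingAlgebra L] [Fintype L] :
    Min (TruthSubalgebra L) where
  min M N :=
    { carrier := M.carrier ∩ N.carrier
      inf_mem := fun h h' => ⟨M.inf_mem h.1 h'.1, N.inf_mem h.2 h'.2⟩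
      sup_mem := fun h h' => ⟨M.sup_mem h.1 h'.1, N.sup_mem h.2 h'.2⟩
      himp_mem := fun h h' => ⟨M.himp_mem h.1 h'.1, N.himp_mem h.2 h'.2⟩
      T_mem := fun l _ h => ⟨M.T_mem l h.1, N.T_mem l h.2⟩
      bot_mem := ⟨M.bot_mem, N.bot_mem⟩
      top_mem := ⟨M.top_mem, N.top_mem⟩ }

/-! ### Pairwise Boolean spaces -/

/-- Pairwise Hausdorff bitopological spaces. -/
def PairwiseHausdorff {X : Type u} (τ₁ τ₂ : TopologicalSpace X) : Prop :=
  ∀ x y : X, x ≠ y → ∃ U V : Set X, IsOpen[τ₁] U ∧ IsOpen[τ₂] V ∧ x ∈ U ∧ y ∈ V ∧ Disjoint U V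

/-- Pairwise zero-dimensional bitopological spaces. -/
def PairwiseZeroDimensional {X : Type u} (τ₁ τ₂ : TopologicalSpace X) : Prop :=
  @IsTopologicalBasis X τ₁ {U | IsOpen[τ₁] U ∧ IsClosed[τ₂] U} ∧
    @IsTopologicalBasis X τ₂ {U | IsOpen[τ₂] U ∧ IsClosed[τ₁] U}

/-- Pairwise compact bitopological spaces. -/
def PairwiseCompact {X : Type u} (τ₁ τ₂ : TopologicalSpace X) : Prop :=
  ∀ 𝒰 : Set (Set X), (∀ U ∈ 𝒰, IsOpen[τ₁] U ∨ IsOpen[τ₂] U) → ⋃₀ 𝒰 = Set.univ →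
    ∃ 𝒱 ⊆ 𝒰, 𝒱.Finite ∧ ⋃₀ 𝒱 = Set.univ

/-- Pairwise Boolean spaces. -/
structure PairwiseBoolean {X : Type u} (τ₁ τ₂ : TopologicalSpace X) : Prop where
  zeroDimensional : PairwiseZeroDimensional τ₁ τ₂
  hausdorff : PairwiseHausdorff τ₁ τ₂
  compact : PairwiseCompact τ₁ τ₂

/-- The objects of `PBS_L`: a pairwise Boolean space with a map `α` from the subalgebras of `L` to
the pairwise closed subspaces, sending `L` to the whole space and meets to intersections. -/
structure PBS (L : Type u) [HeytingAlgebra L] [Fintype L] where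
  /-- the underlying set -/
  carrier : Type u
  /-- the first topology -/
  τ₁ : TopologicalSpace carrier
  /-- the second topology -/
  τ₂ : TopologicalSpace carrier
  pairwiseBoolean : PairwiseBoolean τ₁ τ₂
  /-- the assignment of a pairwise closed subspace to every subalgebra -/
  α : TruthSubalgebra L → Set carrier
  isClosed₁ : ∀ M, IsClosed[τ₁] (α M)
  isClosed₂ : ∀ M, IsClosed[τ₂] (α M)
  α_top : α ⊤ = Set.univ
  α_inf : ∀ M N, α (M ⊓ N) = α M ∩ α N

/-- The morphisms of `PBS_L`: pairwise continuous maps compatible with the maps `α`. -/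
@[ext]
structure PBSHom {L : Type u} [HeytingAlgebra L] [Fintype L] (X Y : PBS L) where
  /-- the underlying map -/
  toFun : X.carrier → Y.carrier
  continuous₁ : Continuous[X.τ₁, Y.τ₁] toFun
  continuous₂ : Continuous[X.τ₂, Y.τ₂] toFun
  map_α : ∀ (M : TruthSubalgebra L) (x : X.carrier), x ∈ X.α M → toFun x ∈ Y.α M

/-- The category `PBS_L`. -/
instance PBS.category (L : Type u) [HeytingAlgebra L] [Fintype L] : Category (PBS L) where
  Hom X Y := PBSHom X Y
  id X :=
    { toFun := fun x => x
      continuous₁ := @continuous_id _ X.τ₁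
      continuous₂ := @continuous_id _ X.τ₂
      map_α := fun _ _ h => h }
  comp {X Y Z} f g :=
    { toFun := fun x => g.toFun (f.toFun x)
      continuous₁ := @Continuous.comp _ _ _ X.τ₁ Y.τ₁ Z.τ₁ _ _ g.continuous₁ f.continuous₁
      continuous₂ := @Continuous.comp _ _ _ X.τ₂ Y.τ₂ Z.τ₂ _ _ g.continuous₂ f.continuous₂
      map_α := fun M x h => g.map_α M _ (f.map_α M x h) }

/-- A compact space whose points are separated by clopen sets is pairwise Boolean when its topology is
taken twice. -/
theorem pairwiseBoolean_same {X : Type u} (τ : TopologicalSpace X) (hc : CompactSpace X)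
    (hs : ∀ x y : X, x ≠ y → ∃ U : Set X, IsClopen U ∧ x ∈ U ∧ y ∉ U) :
    PairwiseBoolean τ τ := by
  have ht : T2Space X := ⟨fun x y h => by
    obtain ⟨U, hU, hx, hy⟩ := hs x y h
    exact ⟨U, Uᶜ, hU.isOpen, hU.compl.isOpen, hx, hy, disjoint_compl_right⟩⟩
  have hd : TotallySeparatedSpace X := by
    refine totallySeparatedSpace_iff_exists_isClopen.2 fun x y h => ?_
    obtain ⟨U, hU, hx, hy⟩ := hs x y h
    exact ⟨U, hU, hx, hy⟩
  have hb : IsTopologicalBasis {U : Set X | IsOpen U ∧ IsClosed U} := by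
    have h := isTopologicalBasis_isClopen (X := X)
    convert h using 3
    exact and_comm
  refine ⟨⟨hb, hb⟩, fun x y h => ?_, fun 𝒰 h𝒰 hcov => ?_⟩
  · obtain ⟨U, hU, hx, hy⟩ := hs x y h
    exact ⟨U, Uᶜ, hU.isOpen, hU.compl.isOpen, hx, hy, disjoint_compl_right⟩
  · obtain ⟨t, ht⟩ := isCompact_univ.elim_finite_subcover (fun U : 𝒰 => U.1)
      (fun U => (h𝒰 U.1 U.2).elim id id) (by rw [← Set.sUnion_eq_iUnion, hcov])
    refine ⟨Subtype.val '' (t : Set 𝒰), ?_, t.finite_toSet.image _, ?_⟩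
    · rintro _ ⟨U, _, rfl⟩
      exact U.2
    · refine Set.eq_univ_of_forall fun x => ?_
      obtain ⟨U, hU, hx⟩ := Set.mem_iUnion₂.1 (ht (Set.mem_univ x))
      exact ⟨U.1, ⟨U, hU, rfl⟩, hx⟩

/-- The object of `PBS_L` given by `L` with the discrete topology taken twice and `α(M) = M`. -/
def truthPBS (L : Type u) [HeytingAlgebra L] [Fintype L] : PBS L where
  carrier := L
  τ₁ := ⊥
  τ₂ := ⊥
  pairwiseBoolean := by
    let : TopologicalSpace L := ⊥
    have : DiscreteTopology L := ⟨rfl⟩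
    exact pairwiseBoolean_same ⊥ inferInstance
      fun x y h => ⟨{x}, isClopen_discrete _, rfl, fun h' => h h'.symm⟩
  α M := M.carrier
  isClosed₁ M := by
    let : TopologicalSpace L := ⊥
    have : DiscreteTopology L := ⟨rfl⟩
    exact isClosed_discrete _
  isClosed₂ M := by
    let : TopologicalSpace L := ⊥
    have : DiscreteTopology L := ⟨rfl⟩
    exact isClosed_discrete _
  α_top := rfl
  α_inf _ _ := rfl

/-! ### The functor from `PBS_L` to `L`-`VL`-algebras -/

theorem continuous_bot_op {X : Type u} {L : Type u} (τ : TopologicalSpace X) {f g : X → L}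
    (hf : Continuous[τ, ⊥] f) (hg : Continuous[τ, ⊥] g) (op : L → L → L) :
    Continuous[τ, ⊥] fun x => op (f x) (g x) := by
  let : TopologicalSpace L := ⊥
  have : DiscreteTopology L := ⟨rfl⟩
  exact (continuous_of_discreteTopology (f := fun p : L × L => op p.1 p.2)).comp (hf.prodMk hg)

section HomAlgebra

variable {L : Type u} [HeytingAlgebra L] [Fintype L] {X : PBS L}

/-- A constant map into `L` whose value lies in every subalgebra. -/
def PBSHom.const (X : PBS L) (l : L) (hl : ∀ M : TruthSubalgebra L, l ∈ M.carrier) :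
    PBSHom X (truthPBS L) where
  toFun _ := l
  continuous₁ := @continuous_const _ _ X.τ₁ ⊥ _
  continuous₂ := @continuous_const _ _ X.τ₂ ⊥ _
  map_α M _ _ := hl M

/-- The pointwise application of a binary operation on `L` under which subalgebras are closed. -/
def PBSHom.op₂ (op : L → L → L)
    (hop : ∀ (M : TruthSubalgebra L) (x y : L), x ∈ M.carrier → y ∈ M.carrier →
      op x y ∈ M.carrier)
    (φ η : PBSHom X (truthPBS L)) : PBSHom X (truthPBS L) where
  toFun x := op (φ.toFun x) (η.toFun x)
  continuous₁ := continuous_bot_op X.τ₁ φ.continuous₁ η.continuous₁ op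
  continuous₂ := continuous_bot_op X.τ₂ φ.continuous₂ η.continuous₂ op
  map_α M x h := hop M _ _ (φ.map_α M x h) (η.map_α M x h)

/-- The underlying map of a morphism into `L`, as a map into the lattice `L`. -/
def PBSHom.val (φ : PBSHom X (truthPBS L)) : X.carrier → L := φ.toFun

theorem PBSHom.val_injective :
    Function.Injective (PBSHom.val : PBSHom X (truthPBS L) → X.carrier → L) :=
  fun _ _ h => PBSHom.ext h

instance : Max (PBSHom X (truthPBS L)) :=
  ⟨PBSHom.op₂ (fun x y => x ⊔ y) fun M _ _ => M.sup_mem⟩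

instance : Min (PBSHom X (truthPBS L)) :=
  ⟨PBSHom.op₂ (fun x y => x ⊓ y) fun M _ _ => M.inf_mem⟩

instance : HImp (PBSHom X (truthPBS L)) :=
  ⟨PBSHom.op₂ (fun x y => x ⇨ y) fun M _ _ => M.himp_mem⟩

instance : Top (PBSHom X (truthPBS L)) := ⟨PBSHom.const X ⊤ fun M => M.top_mem⟩

instance : Bot (PBSHom X (truthPBS L)) := ⟨PBSHom.const X ⊥ fun M => M.bot_mem⟩

instance : Compl (PBSHom X (truthPBS L)) := ⟨fun φ => φ ⇨ ⊥⟩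

instance : LE (PBSHom X (truthPBS L)) := ⟨fun φ η => φ.val ≤ η.val⟩

instance : LT (PBSHom X (truthPBS L)) := ⟨fun φ η => φ.val < η.val⟩

/-- The pointwise Heyting algebra structure on the morphisms into `L`. -/
instance : HeytingAlgebra (PBSHom X (truthPBS L)) :=
  PBSHom.val_injective.heytingAlgebra _ Iff.rfl Iff.rfl (fun _ _ => rfl) (fun _ _ => rfl) rfl rfl
    (fun φ => funext fun x => himp_bot (φ.val x)) (fun _ _ => rfl)

theorem PBSHom.val_sup {ι : Type u} (s : Finset ι) (f : ι → PBSHom X (truthPBS L))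
    (x : X.carrier) : (s.sup f).val x = s.sup fun i => (f i).val x :=
  Finset.apply_sup_eq_sup_comp (fun φ : PBSHom X (truthPBS L) => φ.val x) (fun _ _ => rfl) rfl

theorem PBSHom.val_inf {ι : Type u} (s : Finset ι) (f : ι → PBSHom X (truthPBS L))
    (x : X.carrier) : (s.inf f).val x = s.inf fun i => (f i).val x :=
  Finset.apply_inf_eq_inf_comp (fun φ : PBSHom X (truthPBS L) => φ.val x) (fun _ _ => rfl) rfl

theorem PBSHom.ext_val {φ η : PBSHom X (truthPBS L)} (h : ∀ x, φ.val x = η.val x) : φ = η :=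
  PBSHom.val_injective (funext h)

/-- The pointwise `L`-`VL`-algebra structure on the morphisms into `L`. -/
noncomputable instance : VLAlgebra L (PBSHom X (truthPBS L)) where
  T l φ := PBSHom.op₂ (fun x _ => VLAlgebra.T l x) (fun M _ _ h _ => M.T_mem l h) φ φ
  T_himp_inf_sup l₁ l₂ a b x := VLAlgebra.T_himp_inf_sup l₁ l₂ (a.val x) (b.val x)
  T_le_T_truthT l₁ l₂ a x := VLAlgebra.T_le_T_truthT l₁ l₂ (a.val x)
  T_bot_bot := PBSHom.ext_val fun _ => VLAlgebra.T_bot_bot (L := L)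
  T_of_ne_bot l h := PBSHom.ext_val fun _ => VLAlgebra.T_of_ne_bot l h
  T_top_top := PBSHom.ext_val fun _ => VLAlgebra.T_top_top (L := L)
  T_of_ne_top l h := PBSHom.ext_val fun _ => VLAlgebra.T_of_ne_top l h
  sup_T a := PBSHom.ext_val fun x => by
    rw [PBSHom.val_sup]
    exact VLAlgebra.sup_T (L := L) (a.val x)
  T_sup_himp_bot l a := PBSHom.ext_val fun x => VLAlgebra.T_sup_himp_bot l (a.val x)
  T_inf_T l₁ l₂ a h := PBSHom.ext_val fun x => VLAlgebra.T_inf_T l₁ l₂ (a.val x) h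
  T_top_T l a := PBSHom.ext_val fun x => VLAlgebra.T_top_T l (a.val x)
  T_bot_T l a := PBSHom.ext_val fun x => VLAlgebra.T_bot_T l (a.val x)
  T_T l₁ l₂ a h h' := PBSHom.ext_val fun x => VLAlgebra.T_T l₁ l₂ (a.val x) h h'
  T_top_le a x := VLAlgebra.T_top_le (L := L) (a.val x)
  T_top_inf a b := PBSHom.ext_val fun x => VLAlgebra.T_top_inf (L := L) (a.val x) (b.val x)
  inf_T_iff_le a b x := by
    rw [PBSHom.val_inf]
    exact VLAlgebra.inf_T_iff_le (L := L) (a.val x) (b.val x)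

end HomAlgebra

/-- The contravariant functor `F = Hom(-, L)` from `PBS_L` to `L`-`VL`-algebras. -/
noncomputable def homPBSFunctor (L : Type u) [HeytingAlgebra L] [Fintype L] :
    (PBS L)ᵒᵖ ⥤ VLAlg L where
  obj X := { carrier := PBSHom X.unop (truthPBS L) }
  map f :=
    { toFun := fun η => (show PBSHom _ (truthPBS L) from f.unop ≫ (show _ ⟶ truthPBS L from η))
      map_inf := fun _ _ => rfl
      map_sup := fun _ _ => rfl
      map_himp := fun _ _ => rfl
      map_T := fun _ _ => rfl
      map_bot := rfl
      map_top := rfl }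
  map_id _ := rfl
  map_comp _ _ := rfl

/-! ### The functor from `L`-`VL`-algebras to `PBS_L` -/

section HomSpace

variable (L : Type u) [HeytingAlgebra L] [Fintype L] (A : Type u) [HeytingAlgebra A]
  [VLAlgebra L A]

/-- The set `⟨a⟩` of the homomorphisms into `L` that send `a` to `1`. -/
def basicSet (a : A) : Set (VLHom L A L) := {v | v.toFun a = ⊤}

/-- The topology `σ₁` on `Hom(A, L)`, generated by the sets `⟨a⟩`. -/
abbrev sigma₁ : TopologicalSpace (VLHom L A L) :=
  generateFrom {U | ∃ a : A, U = basicSet L A a}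

/-- The topology `σ₂` on `Hom(A, L)`, generated by the complements of the sets `⟨a⟩`. -/
abbrev sigma₂ : TopologicalSpace (VLHom L A L) :=
  generateFrom {U | ∃ a : A, U = (basicSet L A a)ᶜ}

variable {L A} [Nontrivial L]

theorem basicSet_T (l : L) (a : A) : basicSet L A (VLAlgebra.T l a) = {v | v.toFun a = l} := by
  ext v
  change v.toFun (VLAlgebra.T l a) = ⊤ ↔ v.toFun a = l
  rw [v.map_T]
  change truthT l (v.toFun a) = ⊤ ↔ _
  unfold truthT
  by_cases h : v.toFun a = l
  · simp [h]
  · simp [h]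

theorem basicSet_compl (a : A) :
    (basicSet L A a)ᶜ = basicSet L A (VLAlgebra.T (⊤ : L) a ⇨ ⊥) := by
  ext v
  change ¬ (v.toFun a = ⊤) ↔ v.toFun (VLAlgebra.T (⊤ : L) a ⇨ ⊥) = ⊤
  rw [v.map_himp, v.map_T, v.map_bot]
  change _ ↔ (truthT ⊤ (v.toFun a) ⇨ ⊥) = ⊤
  unfold truthT
  by_cases h : v.toFun a = ⊤
  · simp [h]
  · simp [h]

theorem basicSet_eq_compl (a : A) :
    basicSet L A a = (basicSet L A (VLAlgebra.T (⊤ : L) a ⇨ ⊥))ᶜ := by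
  rw [← basicSet_compl, compl_compl]

theorem sigma₂_eq : sigma₂ L A = sigma₁ L A := by
  unfold sigma₁ sigma₂
  congr 1
  ext U
  constructor
  · rintro ⟨a, rfl⟩
    exact ⟨_, basicSet_compl a⟩
  · rintro ⟨a, rfl⟩
    exact ⟨_, basicSet_eq_compl a⟩

theorem isClopen_eval (a : A) (l : L) :
    @IsClopen _ (sigma₁ L A) {v | v.toFun a = l} := by
  let := sigma₁ L A
  rw [← basicSet_T]
  refine ⟨⟨?_⟩, isOpen_generateFrom_of_mem ⟨_, rfl⟩⟩
  rw [basicSet_compl]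
  exact isOpen_generateFrom_of_mem ⟨_, rfl⟩

theorem compactSpace_hom : @CompactSpace _ (sigma₁ L A) := by
  let : TopologicalSpace L := ⊥
  have : DiscreteTopology L := ⟨rfl⟩
  let := sigma₁ L A
  have hc : IsClosed (Set.range fun (v : VLHom L A L) (a : A) => v.toFun a) := by
    have he : (Set.range fun (v : VLHom L A L) (a : A) => v.toFun a) =
        {f | ∀ a b, f (a ⊓ b) = f a ⊓ f b} ∩ {f | ∀ a b, f (a ⊔ b) = f a ⊔ f b} ∩
        {f | ∀ a b, f (a ⇨ b) = (f a ⇨ f b)} ∩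
        {f | ∀ (l : L) a, f (VLAlgebra.T l a) = VLAlgebra.T l (f a)} ∩
        {f | f ⊥ = ⊥} ∩ {f | f ⊤ = ⊤} := by
      ext f
      constructor
      · rintro ⟨v, rfl⟩
        exact ⟨⟨⟨⟨⟨v.map_inf, v.map_sup⟩, v.map_himp⟩, v.map_T⟩, v.map_bot⟩, v.map_top⟩
      · rintro ⟨⟨⟨⟨⟨h₁, h₂⟩, h₃⟩, h₄⟩, h₅⟩, h₆⟩
        exact ⟨⟨f, h₁, h₂, h₃, h₄, h₅, h₆⟩, rfl⟩
    have h₂ : ∀ (op : L → L → L) (a b c : A),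
        IsClosed {f : A → L | f a = op (f b) (f c)} := fun op a b c => by
      have h : Continuous fun f : A → L => op (f b) (f c) :=
        continuous_bot_op _ (continuous_apply b) (continuous_apply c) op
      exact isClosed_eq (continuous_apply a) h
    rw [he]
    simp only [Set.ofPred_forall]
    refine ((((IsClosed.inter ?_ ?_).inter ?_).inter ?_).inter ?_).inter ?_
    · exact isClosed_iInter fun a => isClosed_iInter fun b => h₂ (· ⊓ ·) _ _ _
    · exact isClosed_iInter fun a => isClosed_iInter fun b => h₂ (· ⊔ ·) _ _ _
    · exact isClosed_iInter fun a => isClosed_iInter fun b => h₂ (· ⇨ ·) _ _ _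
    · exact isClosed_iInter fun l => isClosed_iInter fun a =>
        h₂ (fun x _ => VLAlgebra.T l x) _ a a
    · exact h₂ (fun _ _ => ⊥) _ ⊥ ⊥
    · exact h₂ (fun _ _ => ⊤) _ ⊥ ⊥
  have hi : Topology.IsInducing fun (v : VLHom L A L) (a : A) => v.toFun a := by
    refine ⟨le_antisymm ?_ ?_⟩
    · refine continuous_iff_le_induced.1 (continuous_pi fun a => ?_)
      exact continuous_discrete_rng.2 fun l => (isClopen_eval a l).isOpen
    · refine le_generateFrom ?_
      rintro _ ⟨a, rfl⟩
      have ho : IsOpen ((fun f : A → L => f a) ⁻¹' {⊤}) :=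
        (isOpen_discrete {(⊤ : L)}).preimage (continuous_apply a)
      exact ⟨_, ho, rfl⟩
  refine ⟨hi.isCompact_iff.2 ?_⟩
  rw [Set.image_univ]
  exact hc.isCompact

theorem pairwiseBoolean_hom : PairwiseBoolean (sigma₁ L A) (sigma₂ L A) := by
  rw [sigma₂_eq]
  let := sigma₁ L A
  refine pairwiseBoolean_same _ compactSpace_hom fun v w h => ?_
  have ha : ∃ a, v.toFun a ≠ w.toFun a := by
    by_contra! h'
    exact h (VLHom.ext (funext h'))
  obtain ⟨a, ha⟩ := ha
  exact ⟨_, isClopen_eval a (v.toFun a), rfl, fun h' => ha h'.symm⟩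

theorem isClosed_homSub (M : TruthSubalgebra L) :
    IsClosed[sigma₁ L A] {v : VLHom L A L | ∀ a, v.toFun a ∈ M.carrier} := by
  let := sigma₁ L A
  simp only [Set.ofPred_forall]
  refine isClosed_iInter fun a => ?_
  have he : {v : VLHom L A L | v.toFun a ∈ M.carrier} =
      ⋃ l ∈ M.carrier, {v : VLHom L A L | v.toFun a = l} := by
    ext v
    simp
  rw [he]
  exact M.carrier.toFinite.isClosed_biUnion fun l _ => (isClopen_eval a l).isClosed

variable (L A)

/-- The object `Hom(A, L)` of `PBS_L`, with `α(M) = Hom(A, M)`, the set of the homomorphisms into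
`L` all of whose values lie in `M`. -/
def homSpace : PBS L where
  carrier := VLHom L A L
  τ₁ := sigma₁ L A
  τ₂ := sigma₂ L A
  pairwiseBoolean := pairwiseBoolean_hom
  α M := {v | ∀ a, v.toFun a ∈ M.carrier}
  isClosed₁ := isClosed_homSub
  isClosed₂ M := by
    rw [sigma₂_eq]
    exact isClosed_homSub M
  α_top := Set.eq_univ_of_forall fun _ _ => Set.mem_univ _
  α_inf _ _ := Set.ext fun _ => forall_and

end HomSpace

/-- The contravariant functor `G = Hom(-, L)` from `L`-`VL`-algebras to `PBS_L`. -/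
noncomputable def homVLFunctor (L : Type u) [HeytingAlgebra L] [Fintype L] [Nontrivial L] :
    VLAlg L ⥤ (PBS L)ᵒᵖ where
  obj A := Opposite.op (homSpace L A.carrier)
  map {A B} g := Quiver.Hom.op
    { toFun := fun μ : VLHom L B.carrier L =>
        { toFun := fun a => μ.toFun (g.toFun a)
          map_inf := fun a b => by rw [g.map_inf, μ.map_inf]
          map_sup := fun a b => by rw [g.map_sup, μ.map_sup]
          map_himp := fun a b => by rw [g.map_himp, μ.map_himp]
          map_T := fun l a => by rw [g.map_T, μ.map_T]
          map_bot := by rw [g.map_bot, μ.map_bot]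
          map_top := by rw [g.map_top, μ.map_top] }
      continuous₁ := by
        refine continuous_generateFrom_iff.2 ?_
        rintro _ ⟨a, rfl⟩
        exact isOpen_generateFrom_of_mem ⟨g.toFun a, rfl⟩
      continuous₂ := by
        refine continuous_generateFrom_iff.2 ?_
        rintro _ ⟨a, rfl⟩
        exact isOpen_generateFrom_of_mem ⟨g.toFun a, rfl⟩
      map_α := fun _ _ h a => h (g.toFun a) }
  map_id _ := rfl
  map_comp _ _ := rfl

/-! As in Stone duality, both composites of `homVLFunctor` and `homPBSFunctor` are isomorphic to the
identity through evaluation maps. The two topologies of a pairwise Boolean space coincide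
(`PairwiseBoolean.eq`), so the spaces are Boolean spaces and morphisms into `L` are locally
constant.

For an algebra, a prime ideal `J` selects for each `a` the unique `l` with `T l a ∉ J`, and the
axioms `T_himp_inf_sup` and `T_le_T_truthT` turn this choice into a homomorphism to `L`. With the
prime ideal theorem and the axiom `inf_T_iff_le`, homomorphisms separate elements
(`eq_of_forall_hom`). Conversely, compatibility with `α` forces the value at `v` of a morphism on
the dual space into the image of `v`, so near `v` the morphism is evaluation at an element;
compactness glues these local elements (`evalElement_surjective`).

For a space, indicators of clopen sets separate points, and compactness shows that every
homomorphism from its algebra to `L` is evaluation at a point. Bijectivity alone does not make the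
inverse respect `α`; `mem_α_of_forall` recovers `α` from the values of the morphisms. -/

/-! ### Prime ideals and homomorphisms into `L`. -/

section Algebra

variable {L : Type u} [HeytingAlgebra L] [Fintype L] {A : Type u} [HeytingAlgebra A]
  [VLAlgebra L A]

/-- Modulo a prime ideal, every element has exactly one truth value. -/
theorem existsUnique_T_notMem (J : Order.Ideal A) (hJ : J.IsPrime) (a : A) :
    ∃! l : L, VLAlgebra.T l a ∉ J := by
  have hex : ∃ l : L, VLAlgebra.T l a ∉ J := by
    by_contra! h
    have ht : (Finset.univ.sup fun l : L => VLAlgebra.T l a) ∈ J :=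
      (Order.Ideal.finsetSup_mem_iff J).2 fun l _ => h l
    rw [VLAlgebra.sup_T] at ht
    exact hJ.toIsProper.top_notMem ht
  obtain ⟨l, hl⟩ := hex
  refine ⟨l, hl, fun k hk => ?_⟩
  by_contra hne
  have hb : VLAlgebra.T k a ⊓ VLAlgebra.T l a ∈ J := by
    rw [VLAlgebra.T_inf_T k l a hne]
    exact J.bot_mem
  exact (hJ.mem_or_mem hb).elim hk hl

/-- The truth value of an element modulo a prime ideal. -/
noncomputable def truthValue (L : Type u) [HeytingAlgebra L] [Fintype L] [VLAlgebra L A]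
    (J : Order.Ideal A) (hJ : J.IsPrime) (a : A) : L :=
  (existsUnique_T_notMem J hJ a).choose

theorem truthValue_eq_iff (J : Order.Ideal A) (hJ : J.IsPrime) (a : A) (l : L) :
    truthValue L J hJ a = l ↔ VLAlgebra.T l a ∉ J := by
  have h := (existsUnique_T_notMem (L := L) J hJ a).choose_spec
  exact ⟨fun h' => h' ▸ h.1, fun h' => (h.2 l h').symm⟩

theorem T_truthValue_notMem (J : Order.Ideal A) (hJ : J.IsPrime) (a : A) :
    VLAlgebra.T (truthValue L J hJ a) a ∉ J :=
  (truthValue_eq_iff J hJ a _).1 rfl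

/-- The complement of a prime ideal is closed under meets. By `T_himp_inf_sup` this meet lies below
the `T`-terms of `a ⇨ b`, `a ⊓ b` and `a ⊔ b`, which therefore stay outside `J` too; even `⇨` is
preserved for an arbitrary prime ideal. -/
theorem T_inf_T_truthValue_notMem (J : Order.Ideal A) (hJ : J.IsPrime) (a b : A) :
    VLAlgebra.T (truthValue L J hJ a) a ⊓ VLAlgebra.T (truthValue L J hJ b) b ∉ J :=
  fun h => (hJ.mem_or_mem h).elim (T_truthValue_notMem J hJ a) (T_truthValue_notMem J hJ b)

/-- The homomorphism into the lattice of truth values given by a prime ideal. -/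
noncomputable def VLHom.ofPrime (L : Type u) [HeytingAlgebra L] [Fintype L] [VLAlgebra L A]
    (J : Order.Ideal A) (hJ : J.IsPrime) : VLHom L A L where
  toFun := truthValue L J hJ
  map_inf a b := (truthValue_eq_iff J hJ _ _).2 fun h => T_inf_T_truthValue_notMem J hJ a b <|
    J.lower ((VLAlgebra.T_himp_inf_sup _ _ a b).trans (inf_le_left.trans inf_le_right)) h
  map_sup a b := (truthValue_eq_iff J hJ _ _).2 fun h => T_inf_T_truthValue_notMem J hJ a b <|
    J.lower ((VLAlgebra.T_himp_inf_sup _ _ a b).trans inf_le_right) h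
  map_himp a b := (truthValue_eq_iff J hJ _ _).2 fun h => T_inf_T_truthValue_notMem J hJ a b <|
    J.lower ((VLAlgebra.T_himp_inf_sup _ _ a b).trans (inf_le_left.trans inf_le_left)) h
  map_T l a := (truthValue_eq_iff J hJ _ _).2 fun h => T_truthValue_notMem (L := L) J hJ a <|
    J.lower (VLAlgebra.T_le_T_truthT l _ a) h
  map_bot := (truthValue_eq_iff J hJ _ _).2 <| by
    rw [VLAlgebra.T_bot_bot]
    exact hJ.toIsProper.top_notMem
  map_top := (truthValue_eq_iff J hJ _ _).2 <| by
    rw [VLAlgebra.T_top_top]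
    exact hJ.toIsProper.top_notMem

/-- If the inequality failed, some prime ideal would contain `T l b` but not `T l a`, and its
homomorphism would send `a` to `l` and `b` elsewhere. -/
theorem T_le_T_of_forall_hom {a b : A} (h : ∀ v : VLHom L A L, v.toFun a = v.toFun b) (l : L) :
    VLAlgebra.T l a ≤ VLAlgebra.T l b := by
  by_contra hle
  have hd : Disjoint (Order.PFilter.principal (VLAlgebra.T l a) : Set A)
      (Order.Ideal.principal (VLAlgebra.T l b)) :=
    Set.disjoint_left.2 fun x hx hx' => hle (le_trans hx hx')
  obtain ⟨J, hJ, hb, ha⟩ := DistribLattice.prime_ideal_of_disjoint_filter_ideal hd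
  have hav : truthValue L J hJ a = l :=
    (truthValue_eq_iff J hJ a l).2 fun h' => Set.disjoint_left.1 ha (le_refl _) h'
  have hbv : truthValue L J hJ b = l := (h (VLHom.ofPrime L J hJ)).symm.trans hav
  exact (truthValue_eq_iff J hJ b l).1 hbv (hb (le_refl _))

/-- The homomorphisms into the lattice of truth values separate the elements of an algebra. -/
theorem eq_of_forall_hom {a b : A} (h : ∀ v : VLHom L A L, v.toFun a = v.toFun b) : a = b := by
  have hT : ∀ l : L, VLAlgebra.T l a = VLAlgebra.T l b := fun l =>
    le_antisymm (T_le_T_of_forall_hom h l) (T_le_T_of_forall_hom (fun v => (h v).symm) l)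
  -- Once all `T l a = T l b`, the left side of this axiom is `⊤`, so both implications between `a`
  -- and `b` are `⊤`.
  have hle := VLAlgebra.inf_T_iff_le (L := L) a b
  simp only [hT, himp_self, inf_top_eq, Finset.inf_top, top_le_iff, inf_eq_top_iff,
    himp_eq_top_iff] at hle
  exact le_antisymm hle.1 hle.2

/-! ### Evaluation of an algebra on its dual space. -/

/-- The image of a homomorphism into the lattice of truth values. -/
def VLHom.range (v : VLHom L A L) : TruthSubalgebra L where
  carrier := Set.range v.toFun
  inf_mem := by
    rintro _ _ ⟨a, rfl⟩ ⟨b, rfl⟩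
    exact ⟨_, v.map_inf a b⟩
  sup_mem := by
    rintro _ _ ⟨a, rfl⟩ ⟨b, rfl⟩
    exact ⟨_, v.map_sup a b⟩
  himp_mem := by
    rintro _ _ ⟨a, rfl⟩ ⟨b, rfl⟩
    exact ⟨_, v.map_himp a b⟩
  T_mem := by
    rintro l _ ⟨a, rfl⟩
    exact ⟨_, v.map_T l a⟩
  bot_mem := ⟨_, v.map_bot⟩
  top_mem := ⟨_, v.map_top⟩

theorem VLHom.map_finset_sup {ι : Type*} (v : VLHom L A L) (s : Finset ι) (f : ι → A) :
    v.toFun (s.sup f) = s.sup fun i => v.toFun (f i) :=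
  Finset.apply_sup_eq_sup_comp v.toFun v.map_sup v.map_bot

theorem VLHom.map_finset_inf {ι : Type*} (v : VLHom L A L) (s : Finset ι) (f : ι → A) :
    v.toFun (s.inf f) = s.inf fun i => v.toFun (f i) :=
  Finset.apply_inf_eq_inf_comp v.toFun v.map_inf v.map_top

theorem VLHom.map_T_self (v : VLHom L A L) (a : A) :
    v.toFun (VLAlgebra.T (v.toFun a) a) = ⊤ :=
  (v.map_T _ a).trans (if_pos rfl)

theorem VLHom.map_T_of_ne (v : VLHom L A L) {a : A} {l : L} (h : v.toFun a ≠ l) :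
    v.toFun (VLAlgebra.T l a) = ⊥ :=
  (v.map_T l a).trans (if_neg h)

theorem isTopologicalBasis_basicSet :
    @IsTopologicalBasis _ (sigma₁ L A) {U | ∃ a : A, U = basicSet L A a} := by
  let := sigma₁ L A
  have h := isTopologicalBasis_of_subbasis_of_inter (t := sigma₁ L A)
    (r := {U | ∃ a : A, U = basicSet L A a}) rfl (by
      rintro _ ⟨a, rfl⟩ _ ⟨b, rfl⟩
      refine ⟨a ⊓ b, Set.ext fun v => ?_⟩
      change v.toFun a = ⊤ ∧ v.toFun b = ⊤ ↔ v.toFun (a ⊓ b) = ⊤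
      rw [v.map_inf, inf_eq_top_iff])
  -- The basis obtained so far contains the whole space as an extra member, which is `⟨⊤⟩`.
  rwa [Set.insert_eq_of_mem] at h
  exact ⟨⊤, (Set.eq_univ_of_forall fun v => v.map_top).symm⟩

variable [Nontrivial L]

theorem VLHom.continuous_apply (a : A) :
    Continuous[sigma₁ L A, ⊥] fun v : VLHom L A L => v.toFun a := by
  let : TopologicalSpace L := ⊥
  have : DiscreteTopology L := ⟨rfl⟩
  let := sigma₁ L A
  exact continuous_discrete_rng.2 fun l => (isClopen_eval a l).isOpen

/-- The evaluation at an element of an algebra. -/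
def evalElement (a : A) : PBSHom (homSpace L A) (truthPBS L) where
  toFun := fun v : VLHom L A L => v.toFun a
  continuous₁ := VLHom.continuous_apply (L := L) a
  continuous₂ := by
    change Continuous[sigma₂ L A, ⊥] _
    rw [sigma₂_eq]
    exact VLHom.continuous_apply (L := L) a
  map_α _ _ h := h a

/-- The image of `v` is a subalgebra whose `α` contains `v`, so `φ` takes at `v` a value `v(a)`.
Both `φ` and evaluation at `a` are locally constant, hence agree on a basic neighbourhood. -/
theorem exists_basicSet_eval_eq (φ : PBSHom (homSpace L A) (truthPBS L)) (v : VLHom L A L) :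
    ∃ c a : A, v ∈ basicSet L A c ∧ ∀ w ∈ basicSet L A c, w.toFun a = φ.val w := by
  obtain ⟨a, ha⟩ : φ.val v ∈ v.range.carrier := φ.map_α v.range v fun a => ⟨a, rfl⟩
  let : TopologicalSpace L := ⊥
  have : DiscreteTopology L := ⟨rfl⟩
  let := sigma₁ L A
  have hφ : Continuous fun w : VLHom L A L => φ.val w := φ.continuous₁
  have ho : IsOpen {w : VLHom L A L | w.toFun a = φ.val v ∧ φ.val w = φ.val v} :=
    (isClopen_eval a (φ.val v)).isOpen.inter ((isOpen_discrete {φ.val v}).preimage hφ)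
  obtain ⟨_, ⟨c, rfl⟩, hv, hc⟩ :=
    isTopologicalBasis_basicSet.exists_subset_of_mem_open
      (show v ∈ {w : VLHom L A L | w.toFun a = φ.val v ∧ φ.val w = φ.val v} from ⟨ha, rfl⟩) ho
  exact ⟨c, a, hv, fun w hw => (hc hw).1.trans (hc hw).2.symm⟩

theorem evalElement_surjective :
    Function.Surjective (evalElement : A → PBSHom (homSpace L A) (truthPBS L)) := by
  intro φ
  let := sigma₁ L A
  have := compactSpace_hom (L := L) (A := A)
  obtain ⟨t, ht⟩ := isCompact_univ.elim_finite_subcover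
    (fun p : {p : A × A // ∀ w ∈ basicSet L A p.1, w.toFun p.2 = φ.val w} => basicSet L A p.1.1)
    (fun p => isTopologicalBasis_basicSet.isOpen ⟨p.1.1, rfl⟩) fun v _ => by
      obtain ⟨c, a, hv, hc⟩ := exists_basicSet_eval_eq φ v
      exact Set.mem_iUnion_of_mem ⟨(c, a), hc⟩ hv
  -- `T ⊤ c` takes only the values `⊤` (on `⟨c⟩`) and `⊥`, whereas `c` may take intermediate ones.
  -- Each term thus equals `φ` on its piece and `⊥` off it, so overlaps of the pieces are harmless.
  refine ⟨t.sup fun p => VLAlgebra.T (⊤ : L) p.1.1 ⊓ p.1.2, PBSHom.ext_val ?_⟩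
  intro (w : VLHom L A L)
  change w.toFun _ = φ.val w
  rw [VLHom.map_finset_sup]
  refine le_antisymm (Finset.sup_le fun p _ => ?_) ?_
  · rw [VLHom.map_inf]
    by_cases hp : w.toFun p.1.1 = ⊤
    · exact inf_le_right.trans (p.2 w hp).le
    · rw [VLHom.map_T_of_ne w hp, bot_inf_eq]
      exact bot_le
  · obtain ⟨p, hpt, hp⟩ := Set.mem_iUnion₂.1 (ht (Set.mem_univ w))
    refine le_trans ?_ (Finset.le_sup hpt)
    have h := VLHom.map_T_self w p.1.1
    rw [show w.toFun p.1.1 = ⊤ from hp] at h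
    rw [VLHom.map_inf, h, top_inf_eq, p.2 w hp]

theorem evalElement_bijective :
    Function.Bijective (evalElement : A → PBSHom (homSpace L A) (truthPBS L)) :=
  ⟨fun _ _ h => eq_of_forall_hom fun v : VLHom L A L => congrFun (congrArg PBSHom.val h) v,
    evalElement_surjective⟩

variable (L A) in
/-- The evaluation of the elements of an algebra, as a homomorphism. -/
def evalHom : VLHom L A (PBSHom (homSpace L A) (truthPBS L)) where
  toFun := evalElement
  map_inf a b := PBSHom.ext_val fun v => VLHom.map_inf v a b
  map_sup a b := PBSHom.ext_val fun v => VLHom.map_sup v a b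
  map_himp a b := PBSHom.ext_val fun v => VLHom.map_himp v a b
  map_T l a := PBSHom.ext_val fun v => VLHom.map_T v l a
  map_bot := PBSHom.ext_val fun v => VLHom.map_bot v
  map_top := PBSHom.ext_val fun v => VLHom.map_top v

end Algebra

/-! ### Bijective homomorphisms are isomorphisms. -/

section Inverse

variable {L : Type u} [HeytingAlgebra L] [Fintype L]

/-- The inverse of a bijective homomorphism. -/
def VLHom.inverse {A B : Type u} [HeytingAlgebra A] [VLAlgebra L A] [HeytingAlgebra B]
    [VLAlgebra L B] (f : VLHom L A B) (g : B → A) (hl : Function.LeftInverse g f.toFun)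
    (hr : Function.RightInverse g f.toFun) : VLHom L B A where
  toFun := g
  map_inf a b := hl.injective.eq_iff.1 (by simp only [f.map_inf, hr _])
  map_sup a b := hl.injective.eq_iff.1 (by simp only [f.map_sup, hr _])
  map_himp a b := hl.injective.eq_iff.1 (by simp only [f.map_himp, hr _])
  map_T l a := hl.injective.eq_iff.1 (by simp only [f.map_T, hr _])
  map_bot := hl.injective.eq_iff.1 (by simp only [f.map_bot, hr _])
  map_top := hl.injective.eq_iff.1 (by simp only [f.map_top, hr _])

/-- A bijective homomorphism is an isomorphism. -/
noncomputable def VLAlg.isoOfBijective {A B : VLAlg L} (f : VLHom L A.carrier B.carrier)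
    (hf : Function.Bijective f.toFun) : A ≅ B where
  hom := f
  inv := f.inverse (Equiv.ofBijective _ hf).symm (Equiv.ofBijective _ hf).left_inv
    (Equiv.ofBijective _ hf).right_inv
  hom_inv_id := VLHom.ext (funext (Equiv.ofBijective _ hf).left_inv)
  inv_hom_id := VLHom.ext (funext (Equiv.ofBijective _ hf).right_inv)

end Inverse

/-! ### Coincidence of the two topologies. -/

section Bitopology

variable {X : Type u} {τ₁ τ₂ : TopologicalSpace X}

theorem PairwiseHausdorff.symm (h : PairwiseHausdorff τ₁ τ₂) : PairwiseHausdorff τ₂ τ₁ :=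
  fun x y hxy =>
    let ⟨U, V, hU, hV, hy, hx, hd⟩ := h y x hxy.symm
    ⟨V, U, hV, hU, hx, hy, hd.symm⟩

theorem PairwiseCompact.symm (h : PairwiseCompact τ₁ τ₂) : PairwiseCompact τ₂ τ₁ :=
  fun 𝒰 h𝒰 => h 𝒰 fun U hU => (h𝒰 U hU).symm

/-- This adapts the proof that compact sets can be separated from points. For `x` in a `τ₁`-open
`U`, the space is covered by `U` and by `τ₁`-neighbourhoods of the points outside `U`, each disjoint
from some `τ₂`-neighbourhood of `x`. Finitely many suffice, and the matching `τ₂`-neighbourhoods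
intersect inside `U`. -/
theorem PairwiseHausdorff.le (hh : PairwiseHausdorff τ₁ τ₂) (hc : PairwiseCompact τ₁ τ₂) :
    τ₂ ≤ τ₁ := by
  intro U (hU : IsOpen[τ₁] U)
  refine (@isOpen_iff_forall_mem_open _ τ₂ U).2 fun x hx => ?_
  obtain ⟨𝒱, h𝒱, hfin, hcov⟩ := hc
    {W | IsOpen[τ₁] W ∧ ∃ V, IsOpen[τ₂] V ∧ x ∈ V ∧ V ∩ W ⊆ U} (fun W hW => Or.inl hW.1) (by
      refine Set.eq_univ_of_forall fun y => ?_
      by_cases hy : y ∈ U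
      · exact ⟨U, ⟨hU, Set.univ, @isOpen_univ _ τ₂, Set.mem_univ x, Set.inter_subset_right⟩, hy⟩
      · obtain ⟨W, V, hW, hV, hyW, hxV, hd⟩ := hh y x fun h => hy (h ▸ hx)
        exact ⟨W, ⟨hW, V, hV, hxV, fun z hz => (Set.disjoint_left.1 hd hz.2 hz.1).elim⟩, hyW⟩)
  have hex : ∀ W ∈ 𝒱, ∃ V, IsOpen[τ₂] V ∧ x ∈ V ∧ V ∩ W ⊆ U := fun W hW => (h𝒱 hW).2
  choose! V hV hxV hVU using hex
  have ho : IsOpen[τ₂] (⋂ W ∈ 𝒱, V W) := by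
    let := τ₂
    exact hfin.isOpen_biInter hV
  refine ⟨⋂ W ∈ 𝒱, V W, fun z hz => ?_, ho, Set.mem_iInter₂.2 hxV⟩
  obtain ⟨W, hW, hzW⟩ := hcov.symm.subset (Set.mem_univ z)
  exact hVU W hW ⟨Set.mem_iInter₂.1 hz W hW, hzW⟩

/-- The two topologies of a pairwise Boolean space coincide. -/
theorem PairwiseBoolean.eq (h : PairwiseBoolean τ₁ τ₂) : τ₂ = τ₁ :=
  le_antisymm (h.hausdorff.le h.compact) (h.hausdorff.symm.le h.compact.symm)

end Bitopology

/-! ### Evaluation of a space on its dual algebra. -/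

namespace PBS

variable {L : Type u} [HeytingAlgebra L] [Fintype L] (X : PBS L)

theorem τ₂_eq : X.τ₂ = X.τ₁ := X.pairwiseBoolean.eq

theorem compactSpace : @CompactSpace _ X.τ₁ := by
  let := X.τ₁
  refine ⟨isCompact_of_finite_subcover fun {ι} U hU hcov => ?_⟩
  obtain ⟨𝒱, h𝒱, hfin, h⟩ := X.pairwiseBoolean.compact (Set.range U)
    (by rintro _ ⟨i, rfl⟩; exact Or.inl (hU i))
    (by rw [Set.sUnion_range]; exact Set.univ_subset_iff.1 hcov)
  choose i hi using fun V : 𝒱 => h𝒱 V.2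
  have := hfin.fintype
  classical
  refine ⟨Finset.univ.image i, fun x _ => ?_⟩
  obtain ⟨V, hV, hx⟩ := h.symm.subset (Set.mem_univ x)
  refine Set.mem_iUnion₂.2 ⟨i ⟨V, hV⟩, Finset.mem_image_of_mem _ (Finset.mem_univ _), ?_⟩
  rwa [hi ⟨V, hV⟩]

theorem isTopologicalBasis_isClopen : @IsTopologicalBasis _ X.τ₁ {U | @IsClopen _ X.τ₁ U} := by
  have h := X.pairwiseBoolean.zeroDimensional.1
  rw [X.τ₂_eq] at h
  convert h using 3
  exact and_comm

theorem exists_isClopen_of_ne {x y : X.carrier} (h : x ≠ y) :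
    ∃ U, @IsClopen _ X.τ₁ U ∧ x ∈ U ∧ y ∉ U := by
  let := X.τ₁
  obtain ⟨V, W, hV, -, hx, hy, hd⟩ := X.pairwiseBoolean.hausdorff x y h
  obtain ⟨U, hU, hxU, hUV⟩ := X.isTopologicalBasis_isClopen.exists_subset_of_mem_open hx hV
  exact ⟨U, hU, hxU, fun h' => Set.disjoint_left.1 hd (hUV h') hy⟩

variable {X}

theorem α_mono {M N : TruthSubalgebra L} (h : M.carrier ⊆ N.carrier) : X.α M ⊆ X.α N := by
  have he : M ⊓ N = M := TruthSubalgebra.ext (Set.inter_eq_left.2 h)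
  rw [← he, X.α_inf]
  exact Set.inter_subset_right

open Classical in
/-- The map with value `l` on a clopen set and `0` elsewhere. -/
noncomputable def indicator {U : Set X.carrier} (hU : @IsClopen _ X.τ₁ U) (l : L)
    (hl : ∀ M : TruthSubalgebra L, ∀ x ∈ U, x ∈ X.α M → l ∈ M.carrier) :
    PBSHom X (truthPBS L) :=
  have hc : Continuous[X.τ₁, ⊥] fun x => if x ∈ U then l else ⊥ := by
    let := X.τ₁
    let : TopologicalSpace L := ⊥
    refine continuous_const.if (fun x hx => ?_) continuous_const
    rw [show {x | x ∈ U} = U from rfl, hU.frontier_eq] at hx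
    exact hx.elim
  { toFun := fun x => (if x ∈ U then l else ⊥ : L)
    continuous₁ := hc
    continuous₂ := by rw [X.τ₂_eq]; exact hc
    map_α := fun M x hx => by
      change (if x ∈ U then l else ⊥ : L) ∈ M.carrier
      split_ifs with h
      · exact hl M x h hx
      · exact M.bot_mem }

theorem indicator_of_mem {U : Set X.carrier} {hU : @IsClopen _ X.τ₁ U} {l : L}
    {hl : ∀ M : TruthSubalgebra L, ∀ x ∈ U, x ∈ X.α M → l ∈ M.carrier} {x : X.carrier}
    (hx : x ∈ U) : (indicator hU l hl).val x = l :=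
  if_pos hx

/-- The characteristic function of a clopen set. -/
noncomputable def charMap {U : Set X.carrier} (hU : @IsClopen _ X.τ₁ U) :
    PBSHom X (truthPBS L) :=
  indicator hU ⊤ fun M _ _ _ => M.top_mem

theorem charMap_of_mem {U : Set X.carrier} {hU : @IsClopen _ X.τ₁ U} {x : X.carrier}
    (hx : x ∈ U) : (charMap hU).val x = ⊤ :=
  if_pos hx

theorem charMap_of_notMem {U : Set X.carrier} {hU : @IsClopen _ X.τ₁ U} {x : X.carrier}
    (hx : x ∉ U) : (charMap hU).val x = ⊥ :=
  if_neg hx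

theorem isClopen_fiber (φ : PBSHom X (truthPBS L)) (l : L) :
    @IsClopen _ X.τ₁ {x | φ.val x = l} := by
  let := X.τ₁
  let : TopologicalSpace L := ⊥
  have : DiscreteTopology L := ⟨rfl⟩
  have hφ : Continuous φ.val := φ.continuous₁
  exact (isClopen_discrete {l}).preimage hφ

variable (X) in
/-- A point lies in the subspace of the intersection of all subalgebras whose subspaces contain
it. -/
theorem exists_minimal_subalgebra (x : X.carrier) :
    ∃ N : TruthSubalgebra L, x ∈ X.α N ∧
      ∀ M : TruthSubalgebra L, x ∈ X.α M → N.carrier ⊆ M.carrier := by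
  have hx : ⊤ ∈ {N : TruthSubalgebra L | x ∈ X.α N} := by
    change x ∈ X.α ⊤
    rw [X.α_top]
    exact Set.mem_univ x
  have hwf : WellFounded fun M N : TruthSubalgebra L => M.carrier ⊂ N.carrier :=
    InvImage.wf TruthSubalgebra.carrier wellFounded_lt
  obtain ⟨N, hN, hmin⟩ := hwf.has_min _ ⟨⊤, hx⟩
  refine ⟨N, hN, fun M hM => ?_⟩
  by_contra hNM
  -- The family is closed under intersection, so a minimal member is the least one.
  refine hmin (N ⊓ M) ?_ ⟨Set.inter_subset_left, fun h => hNM fun l hl => (h hl).2⟩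
  change x ∈ X.α (N ⊓ M)
  rw [X.α_inf]
  exact ⟨hN, hM⟩

/-- Let `N` be the least subalgebra with `x ∈ α(N)`. Every `l ∈ N` is the value at `x` of some
morphism, so the hypothesis gives `N ⊆ M`, and `α` is monotone. -/
theorem mem_α_of_forall {x : X.carrier} {M : TruthSubalgebra L}
    (h : ∀ φ : PBSHom X (truthPBS L), φ.val x ∈ M.carrier) : x ∈ X.α M := by
  obtain ⟨N, hxN, hN⟩ := X.exists_minimal_subalgebra x
  refine α_mono (fun l hl => ?_) hxN
  let := X.τ₁
  -- Finiteness of `L` leaves finitely many closed sets `α(K)` missing `x`, so a clopen `U` around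
  -- `x` avoids them all. If `y ∈ U` lies in `α(K)`, then so does `x`, whence `l ∈ N ⊆ K`, and the
  -- indicator of `U` with value `l` is a morphism.
  have hfin : {K : TruthSubalgebra L | x ∉ X.α K}.Finite :=
    Set.Finite.of_injOn (f := TruthSubalgebra.carrier) (t := Set.univ) (fun _ _ => Set.mem_univ _)
      (fun _ _ _ _ h => TruthSubalgebra.ext h) Set.finite_univ
  have ho : IsOpen (⋂ K ∈ {K : TruthSubalgebra L | x ∉ X.α K}, (X.α K)ᶜ) :=
    hfin.isOpen_biInter fun K _ => (X.isClosed₁ K).isOpen_compl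
  have hxo : x ∈ ⋂ K ∈ {K : TruthSubalgebra L | x ∉ X.α K}, (X.α K)ᶜ :=
    Set.mem_iInter₂.2 fun K hK => hK
  obtain ⟨U, hU, hxU, hUo⟩ := X.isTopologicalBasis_isClopen.exists_subset_of_mem_open hxo ho
  have hlU : ∀ K : TruthSubalgebra L, ∀ y ∈ U, y ∈ X.α K → l ∈ K.carrier := fun K y hy hyK => by
    by_contra hlK
    exact Set.mem_iInter₂.1 (hUo hy) K (fun hxK => hlK (hN K hxK hl)) hyK
  have hφ := h (indicator hU l hlU)
  rwa [indicator_of_mem hxU] at hφ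

/-- The evaluation at a point of a space. -/
def evalPoint (x : X.carrier) : VLHom L (PBSHom X (truthPBS L)) L where
  toFun φ := φ.val x
  map_inf _ _ := rfl
  map_sup _ _ := rfl
  map_himp _ _ := rfl
  map_T _ _ := rfl
  map_bot := rfl
  map_top := rfl

variable [Nontrivial L]

theorem evalPoint_injective :
    Function.Injective (evalPoint : X.carrier → VLHom L (PBSHom X (truthPBS L)) L) := by
  intro x y h
  by_contra hne
  obtain ⟨U, hU, hx, hy⟩ := X.exists_isClopen_of_ne hne
  have h' := congrArg (fun v => v.toFun (charMap hU)) h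
  change (charMap hU).val x = (charMap hU).val y at h'
  rw [charMap_of_mem hx, charMap_of_notMem hy] at h'
  exact top_ne_bot h'

/-- The required point lies in all the closed sets where `φ` takes the value `v(φ)`. If finitely
many of them had no common point, the meet of the corresponding `T (v φ) φ` would be `⊥`, although
`v` sends it to `⊤`. -/
theorem evalPoint_surjective :
    Function.Surjective (evalPoint : X.carrier → VLHom L (PBSHom X (truthPBS L)) L) := by
  intro v
  let := X.τ₁
  have := X.compactSpace
  obtain ⟨x, hx⟩ := CompactSpace.iInter_nonempty
    (t := fun φ : PBSHom X (truthPBS L) => {x | φ.val x = v.toFun φ})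
    (fun φ => (isClopen_fiber φ _).isClosed) fun s => by
      by_contra hs
      have hb : (s.inf fun φ => VLAlgebra.T (v.toFun φ) φ) = ⊥ := PBSHom.ext_val fun x => by
        have hex : ∃ φ ∈ s, φ.val x ≠ v.toFun φ := by
          by_contra! h
          exact hs ⟨x, Set.mem_iInter₂.2 h⟩
        obtain ⟨φ, hφ, hne⟩ := hex
        rw [PBSHom.val_inf]
        refine le_bot_iff.1 ((Finset.inf_le hφ).trans ?_)
        exact (VLHom.map_T_of_ne (evalPoint x) hne).le
      have h := congrArg v.toFun hb
      simp only [v.map_finset_inf, v.map_T_self, Finset.inf_top, v.map_bot] at h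
      exact top_ne_bot h
  exact ⟨x, VLHom.ext (funext fun φ => Set.mem_iInter.1 hx φ)⟩

theorem evalPoint_bijective :
    Function.Bijective (evalPoint : X.carrier → VLHom L (PBSHom X (truthPBS L)) L) :=
  ⟨evalPoint_injective, evalPoint_surjective⟩

variable (X) in
/-- The evaluation at the points of a space, as a morphism. -/
def evalPointHom : PBSHom X (homSpace L (PBSHom X (truthPBS L))) where
  toFun := evalPoint
  continuous₁ := by
    refine continuous_generateFrom_iff.2 ?_
    rintro _ ⟨φ, rfl⟩
    exact (isClopen_fiber φ ⊤).2
  continuous₂ := by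
    refine continuous_generateFrom_iff.2 ?_
    rintro _ ⟨φ, rfl⟩
    rw [X.τ₂_eq]
    exact (isClopen_fiber φ ⊤).1.isOpen_compl
  map_α M _ hx φ := φ.map_α M _ hx

/-- The preimage of a clopen `U` is the basic set of its characteristic function. -/
theorem continuous_evalPoint_inverse {g : VLHom L (PBSHom X (truthPBS L)) L → X.carrier}
    (hg : Function.RightInverse g evalPoint) :
    Continuous[sigma₁ L (PBSHom X (truthPBS L)), X.τ₁] g := by
  let := X.τ₁
  let := sigma₁ L (PBSHom X (truthPBS L))
  refine X.isTopologicalBasis_isClopen.continuous_iff.2 fun U hU => ?_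
  refine isOpen_generateFrom_of_mem ⟨charMap hU, ?_⟩
  ext v
  obtain ⟨x, rfl⟩ : ∃ x, evalPoint x = v := ⟨g v, hg v⟩
  have hx : g (evalPoint x) = x := evalPoint_injective (hg _)
  change g (evalPoint x) ∈ U ↔ (charMap hU).val x = ⊤
  rw [hx]
  refine ⟨charMap_of_mem, fun h => ?_⟩
  by_contra hxU
  rw [charMap_of_notMem hxU] at h
  exact bot_ne_top h

/-- The inverse of the evaluation at the points of a space. -/
def evalPointInv (g : VLHom L (PBSHom X (truthPBS L)) L → X.carrier)
    (hg : Function.RightInverse g evalPoint) : PBSHom (homSpace L (PBSHom X (truthPBS L))) X where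
  toFun := g
  continuous₁ := continuous_evalPoint_inverse hg
  continuous₂ := by
    change Continuous[sigma₂ L _, X.τ₂] g
    rw [X.τ₂_eq, sigma₂_eq]
    exact continuous_evalPoint_inverse hg
  map_α M v hv := mem_α_of_forall fun φ => by
    have h : (evalPoint (g v)).toFun φ = VLHom.toFun v φ := congrArg (fun w => VLHom.toFun w φ)
      (hg v)
    change (evalPoint (g v)).toFun φ ∈ _
    rw [h]
    exact hv φ

variable (X) in
/-- A space is isomorphic to its double dual. -/
noncomputable def evalPointIso : X ≅ homSpace L (PBSHom X (truthPBS L)) where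
  hom := X.evalPointHom
  inv := evalPointInv (Equiv.ofBijective _ X.evalPoint_bijective).symm
    (Equiv.ofBijective _ X.evalPoint_bijective).right_inv
  hom_inv_id := PBSHom.ext (funext (Equiv.ofBijective _ X.evalPoint_bijective).left_inv)
  inv_hom_id := PBSHom.ext (funext (Equiv.ofBijective _ X.evalPoint_bijective).right_inv)

end PBS

/-! ### The natural isomorphisms and the equivalence. -/

/-- The evaluation isomorphisms of the algebras. -/
noncomputable def unitIso (L : Type u) [HeytingAlgebra L] [Fintype L] [Nontrivial L] :
    𝟭 (VLAlg L) ≅ homVLFunctor L ⋙ homPBSFunctor L :=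
  NatIso.ofComponents
    (fun A => VLAlg.isoOfBijective (B := (homVLFunctor L ⋙ homPBSFunctor L).obj A)
      (evalHom L A.carrier) evalElement_bijective)
    -- Both ways around the square, `a` goes to `v ↦ v(g a)` by definition.
    fun _ => rfl

/-- The evaluation isomorphisms of the spaces. -/
noncomputable def counitIso (L : Type u) [HeytingAlgebra L] [Fintype L] [Nontrivial L] :
    homPBSFunctor L ⋙ homVLFunctor L ≅ 𝟭 (PBS L)ᵒᵖ :=
  NatIso.ofComponents (fun X => X.unop.evalPointIso.op) fun _ => rfl

theorem theorem1 (L : Type u) [HeytingAlgebra L] [Fintype L] [Nontrivial L] :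
    ∃ e : VLAlg L ≌ (PBS L)ᵒᵖ,
      e.functor = homVLFunctor L ∧ e.inverse = homPBSFunctor L :=
  -- `Equivalence.mk` adjusts the unit to satisfy the triangle identity and leaves the two functors
  -- unchanged.
  ⟨CategoryTheory.Equivalence.mk _ _ (unitIso L) (counitIso L), rfl, rfl⟩
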